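/- Let $\Omega$ be a separable metrizable topological space with Borel $\sigma$-algebra $\mathcal F$, and let $\mathfrak P$ be a nonempty set of Borel probability measures on $\Omega$ that is compact in the topology of weak convergence. For each $\mathbb P\in\mathfrak P$ let $\phi_{\mathbb P}\colon[0,\infty)\to[0,\infty]$ be an Orlicz function, i.e. a lower semicontinuous, nondecreasing, convex function with $\phi_{\mathbb P}(0)=0$ for which there are $x_0,x_1>0$ with $\phi_{\mathbb P}(x_0)<\infty$ and $\phi_{\mathbb P}(x_1)>0$. Suppose that $\phi_{\rm Max}(x):=\sup_{\mathbb P\in\mathfrak P}\phi_{\mathbb P}(x)<\infty$ for all $x\in[0,\infty)$. Let $L^0(\mathfrak P)$ be the space of real random variables on $(\Omega,\mathcal F)$ modulo $\mathfrak P$-quasi-sure equality (i.e. equality $\mathbb P$-a.s. for every $\mathbb P\in\mathfrak P$), and let $L^\Phi(\mathfrak P)$ be the subspace of those $X\in L^0(\mathfrak P)$ with $$\|X\|_{L^\Phi(\mathfrak P)}:=\inf\Big\{\lambda>0\;\Big|\;\sup_{\mathbb P\in\mathfrak P}\mathbb E_{\mathbb P}\big[\phi_{\mathbb P}(\lambda^{-1}|X|)\big]\le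 1\Big\}<\infty ,$$ normed by $\|\cdot\|_{L^\Phi(\mathfrak P)}$. Let $\mathcal C$ be the closure in $L^\Phi(\mathfrak P)$ of the set of equivalence classes of bounded continuous functions on $\Omega$. Let $\mathbf{ca}(\mathcal C)$ be the set of all finite signed measures $\mu$ on $(\Omega,\mathcal F)$ such that $|\mu|(N)=0$ for every $N\in\mathcal F$ with $\sup_{\mathbb P\in\mathfrak P}\mathbb P(N)=0$, every $X\in\mathcal C$ is $|\mu|$-integrable, and $\mathcal C\ni X\mapsto\int X\,d|\mu|$ is continuous. Then $\mathcal C^*=\mathbf{ca}(\mathcal C)$: the set $\mathbf{ca}(\mathcal C)$ is a linear subspace of the space of finite signed measures, and the map that sends $\mu\in\mathbf{ca}(\mathcal C)$ to the functional $X\mapsto\int X\,d\mu$ is a well-defined linear bijection from $\mathbf{ca}(\mathcal C)$ onto the space $\mathcal C^*$ of continuous linear functionals on $\mathcal C$. -/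

import Mathlib

open MeasureTheory Filter Topology
open scoped NNReal ENNReal BoundedContinuousFunction

/-- An Orlicz function `[0,∞) → [0,∞]`. -/
structure OrliczFunction where
  toFun : ℝ≥0 → ℝ≥0∞
  lsc : LowerSemicontinuous toFun
  mono : Monotone toFun
  convex : ConvexOn ℝ≥0 Set.univ toFun
  map_zero : toFun 0 = 0
  exists_finite : ∃ x₀ : ℝ≥0, 0 < x₀ ∧ toFun x₀ < ∞
  exists_pos : ∃ x₁ : ℝ≥0, 0 < x₁ ∧ 0 < toFun x₁

namespace RobustOrlicz

section General

variable {Ω : Type*} [MeasurableSpace Ω]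

/-- The filter of events that hold quasi-surely, i.e. `P`-almost surely for every `P ∈ 𝔓`. -/
def qs (𝔓 : Set (ProbabilityMeasure Ω)) : Filter Ω :=
  ⨆ P : 𝔓, ae ((P : ProbabilityMeasure Ω) : Measure Ω)

theorem eventuallyEq_qs {𝔓 : Set (ProbabilityMeasure Ω)} {f g : Ω → ℝ} :
    f =ᶠ[qs 𝔓] g ↔ ∀ P : 𝔓, f =ᵐ[((P : ProbabilityMeasure Ω) : Measure Ω)] g := by
  simp [qs, Filter.EventuallyEq, Filter.eventually_iSup]

/-- `f` is a (measurable) representative of the quasi-sure equivalence class `X`. -/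
def IsRep {𝔓 : Set (ProbabilityMeasure Ω)} (f : Ω → ℝ) (X : (qs 𝔓).Germ ℝ) : Prop :=
  Measurable f ∧ (f : (qs 𝔓).Germ ℝ) = X

/-- The space of real random variables up to quasi-sure equality. -/
def L0 (𝔓 : Set (ProbabilityMeasure Ω)) : Submodule ℝ ((qs 𝔓).Germ ℝ) where
  carrier := {X | ∃ f : Ω → ℝ, IsRep f X}
  zero_mem' := ⟨0, measurable_zero, rfl⟩
  add_mem' := by
    rintro _ _ ⟨f, hf, rfl⟩ ⟨g, hg, rfl⟩
    exact ⟨f + g, hf.add hg, rfl⟩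
  smul_mem' := by
    rintro c _ ⟨f, hf, rfl⟩
    exact ⟨c • f, hf.const_smul c, rfl⟩

variable {𝔓 : Set (ProbabilityMeasure Ω)} (φ : 𝔓 → OrliczFunction)

/-- The pointwise supremum of the family of Orlicz functions. -/
noncomputable def phiMax (x : ℝ≥0) : ℝ≥0∞ := ⨆ P : 𝔓, (φ P).toFun x

/-- `sup_{P ∈ 𝔓} E_P[φ_P(l⁻¹ |X|)]`. -/
noncomputable def modular (l : ℝ≥0) (X : (qs 𝔓).Germ ℝ) : ℝ≥0∞ :=
  X.liftOn
    (fun f => ⨆ P : 𝔓, ∫⁻ ω, (φ P).toFun (l⁻¹ * ‖f ω‖₊) ∂((P : ProbabilityMeasure Ω) : Measure Ω))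
    (by
      intro f g hfg
      refine iSup_congr fun P => lintegral_congr_ae ?_
      filter_upwards [eventuallyEq_qs.1 hfg P] with ω hω
      rw [hω])

/-- The robust Luxemburg norm, with values in `[0,∞]`. -/
noncomputable def luxemburg (X : (qs 𝔓).Germ ℝ) : ℝ≥0∞ :=
  ⨅ (l : ℝ≥0) (_ : 0 < l) (_ : modular φ l X ≤ 1), (l : ℝ≥0∞)

variable {φ}

theorem modular_coe (l : ℝ≥0) (f : Ω → ℝ) :
    modular φ l (f : (qs 𝔓).Germ ℝ) =
      ⨆ P : 𝔓, ∫⁻ ω, (φ P).toFun (l⁻¹ * ‖f ω‖₊) ∂((P : ProbabilityMeasure Ω) : Measure Ω) := rfl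

theorem luxemburg_le {X : (qs 𝔓).Germ ℝ} {l : ℝ≥0} (hl : 0 < l) (h : modular φ l X ≤ 1) :
    luxemburg φ X ≤ l := iInf_le_of_le l (iInf_le_of_le hl (iInf_le _ h))

theorem exists_of_luxemburg_lt {X : (qs 𝔓).Germ ℝ} {c : ℝ≥0∞} (h : luxemburg φ X < c) :
    ∃ l : ℝ≥0, 0 < l ∧ modular φ l X ≤ 1 ∧ (l : ℝ≥0∞) < c := by
  simp only [luxemburg, iInf_lt_iff] at h
  obtain ⟨l, hl, hm, hc⟩ := h
  exact ⟨l, hl, hm, hc⟩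

theorem luxemburg_zero : luxemburg φ (0 : (qs 𝔓).Germ ℝ) = 0 := by
  refine le_antisymm (ENNReal.le_of_forall_pos_le_add fun ε hε _ => ?_) zero_le
  rw [zero_add]
  refine luxemburg_le hε ?_
  change modular φ ε ((0 : Ω → ℝ) : (qs 𝔓).Germ ℝ) ≤ 1
  rw [modular_coe]
  simp [(φ _).map_zero]

theorem luxemburg_add_le {X Y : (qs 𝔓).Germ ℝ} (hX : X ∈ L0 𝔓) (hY : Y ∈ L0 𝔓) :
    luxemburg φ (X + Y) ≤ luxemburg φ X + luxemburg φ Y := by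
  have key : ∀ a b : ℝ≥0, 0 < a → 0 < b → modular φ a X ≤ 1 → modular φ b Y ≤ 1 →
      luxemburg φ (X + Y) ≤ a + b := by
    intro a b ha hb hXa hYb
    obtain ⟨f, hf, rfl⟩ := hX
    obtain ⟨g, hg, rfl⟩ := hY
    rw [modular_coe] at hXa hYb
    rw [← ENNReal.coe_add]
    refine luxemburg_le (by positivity) ?_
    change modular φ (a + b) ((f + g : Ω → ℝ) : (qs 𝔓).Germ ℝ) ≤ 1
    rw [modular_coe]
    refine iSup_le fun P => ?_
    have h1 := (le_iSup _ P).trans hXa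
    have h2 := (le_iSup _ P).trans hYb
    have hab : a / (a + b) + b / (a + b) = 1 := by
      rw [← add_div]; exact div_self (by positivity)
    calc _ ≤ ∫⁻ ω, ((a / (a + b) : ℝ≥0) : ℝ≥0∞) * (φ P).toFun (a⁻¹ * ‖f ω‖₊)
              + ((b / (a + b) : ℝ≥0) : ℝ≥0∞) * (φ P).toFun (b⁻¹ * ‖g ω‖₊)
              ∂((P : ProbabilityMeasure Ω) : Measure Ω) := by
            refine lintegral_mono fun ω => ?_
            refine ((φ P).mono ?_).trans
              ((φ P).convex.2 (Set.mem_univ _) (Set.mem_univ _) zero_le zero_le hab)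
            have e : (a / (a + b)) • (a⁻¹ * ‖f ω‖₊) + (b / (a + b)) • (b⁻¹ * ‖g ω‖₊)
                = (a + b)⁻¹ * (‖f ω‖₊ + ‖g ω‖₊) := by
              simp only [smul_eq_mul]
              field_simp
            rw [e]
            gcongr
            exact nnnorm_add_le _ _
      _ ≤ 1 := by
            rw [lintegral_add_left, lintegral_const_mul, lintegral_const_mul]
            · calc _ ≤ ((a / (a + b) : ℝ≥0) : ℝ≥0∞) * 1 + ((b / (a + b) : ℝ≥0) : ℝ≥0∞) * 1 := by
                    gcongr
                _ = 1 := by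
                    rw [mul_one, mul_one, ← ENNReal.coe_add, hab, ENNReal.coe_one]
            · exact (φ P).mono.measurable.comp (measurable_const.mul hg.nnnorm)
            · exact (φ P).mono.measurable.comp (measurable_const.mul hf.nnnorm)
            · exact measurable_const.mul
                ((φ P).mono.measurable.comp (measurable_const.mul hf.nnnorm))
  refine le_of_forall_gt_imp_ge_of_dense fun c hc => ?_
  obtain ⟨u, v, hu, hv, huv⟩ : ∃ u v, luxemburg φ X < u ∧ luxemburg φ Y < v ∧ u + v ≤ c := by
    rcases eq_or_ne c ∞ with rfl | hct
    · have h := ENNReal.add_lt_top.1 hc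
      exact ⟨∞, ∞, h.1, h.2, le_top⟩
    · have h := ENNReal.add_lt_top.1 (hc.trans_le le_top)
      obtain ⟨d, hd, hdc⟩ := ENNReal.lt_iff_exists_add_pos_lt.1 hc
      refine ⟨luxemburg φ X + (d / 2 : ℝ≥0), luxemburg φ Y + (d / 2 : ℝ≥0), ?_, ?_, ?_⟩
      · exact ENNReal.lt_add_right h.1.ne (by simpa using hd.ne')
      · exact ENNReal.lt_add_right h.2.ne (by simpa using hd.ne')
      · refine le_trans (le_of_eq ?_) hdc.le
        rw [add_add_add_comm, ← ENNReal.coe_add, add_halves]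
  obtain ⟨a, ha, ham, hau⟩ := exists_of_luxemburg_lt hu
  obtain ⟨b, hb, hbm, hbv⟩ := exists_of_luxemburg_lt hv
  exact (key a b ha hb ham hbm).trans ((add_le_add hau.le hbv.le).trans huv)

theorem luxemburg_smul_le (c : ℝ) (X : (qs 𝔓).Germ ℝ) (hX : X ∈ L0 𝔓)
    (hfin : luxemburg φ X < ∞) :
    luxemburg φ (c • X) ≤ (‖c‖₊ : ℝ≥0∞) * luxemburg φ X := by
  rcases eq_or_ne c 0 with rfl | hc
  · simp [luxemburg_zero]
  have hc' : 0 < ‖c‖₊ := by simpa using hc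
  rw [mul_comm, ← ENNReal.div_le_iff (by simpa using hc) ENNReal.coe_ne_top]
  refine le_of_forall_gt_imp_ge_of_dense fun d hd => ?_
  obtain ⟨l, hl, hm, hld⟩ := exists_of_luxemburg_lt hd
  refine le_trans ?_ hld.le
  rw [ENNReal.div_le_iff (by simpa using hc) ENNReal.coe_ne_top, ← ENNReal.coe_mul]
  refine luxemburg_le (by positivity) (le_trans (le_of_eq ?_) hm)
  obtain ⟨f, hf, rfl⟩ := hX
  change modular φ (l * ‖c‖₊) ((c • f : Ω → ℝ) : (qs 𝔓).Germ ℝ) = _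
  rw [modular_coe, modular_coe]
  refine iSup_congr fun P => lintegral_congr fun ω => ?_
  congr 1
  simp only [Pi.smul_apply, nnnorm_smul]
  field_simp

theorem eq_zero_of_luxemburg {X : (qs 𝔓).Germ ℝ} (hX : X ∈ L0 𝔓)
    (h0 : luxemburg φ X = 0) : X = 0 := by
  obtain ⟨f, hf, rfl⟩ := hX
  refine Germ.coe_eq.2 (eventuallyEq_qs.2 fun P => ?_)
  obtain ⟨x, hx, hpos⟩ := (φ P).exists_pos
  set μ : Measure Ω := ((P : ProbabilityMeasure Ω) : Measure Ω)
  have hgrow : ∀ n : ℕ, 0 < n → (n : ℝ≥0∞) * (φ P).toFun x ≤ (φ P).toFun (n * x) := by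
    intro n hn
    have hn' : (n : ℝ≥0) ≠ 0 := by positivity
    have hle : (n : ℝ≥0)⁻¹ ≤ 1 := inv_le_one_of_one_le₀ (by exact_mod_cast hn)
    have := (φ P).convex.2 (Set.mem_univ ((n : ℝ≥0) * x)) (Set.mem_univ 0)
      zero_le zero_le (add_tsub_cancel_of_le hle)
    simp only [smul_eq_mul, mul_zero, add_zero, (φ P).map_zero, smul_zero] at this
    rw [inv_mul_cancel_left₀ hn'] at this
    calc (n : ℝ≥0∞) * (φ P).toFun x
        ≤ (n : ℝ≥0∞) * ((n : ℝ≥0)⁻¹ • (φ P).toFun (n * x)) := by gcongr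
      _ = (φ P).toFun (n * x) := by
        rw [ENNReal.smul_def, smul_eq_mul, ← mul_assoc, ENNReal.coe_inv hn', ENNReal.coe_natCast,
          ENNReal.mul_inv_cancel (by exact_mod_cast hn') (ENNReal.natCast_ne_top n), one_mul]
  have hnull : ∀ ε : ℝ≥0, 0 < ε → μ {ω | ε ≤ ‖f ω‖₊} = 0 := by
    intro ε hε
    have hb : ∀ n : ℕ, 0 < n →
        (n : ℝ≥0∞) * ((φ P).toFun x * μ {ω | ε ≤ ‖f ω‖₊}) ≤ 1 := by
      intro n hn
      have hlt : luxemburg φ (f : (qs 𝔓).Germ ℝ) < ((ε / (n * x) : ℝ≥0) : ℝ≥0∞) := by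
        rw [h0]
        have : 0 < ε / (n * x) := by positivity
        exact_mod_cast this
      obtain ⟨l, hl, hm, hlt⟩ := exists_of_luxemburg_lt hlt
      rw [modular_coe] at hm
      have hm := (le_iSup _ P).trans hm
      have hlt : l < ε / (n * x) := by exact_mod_cast hlt
      have hlx : n * x ≤ l⁻¹ * ε := by
        have h1 : l * (n * x) ≤ ε := ((lt_div_iff₀ (by positivity)).1 hlt).le
        calc n * x = l⁻¹ * (l * (n * x)) := by field_simp
          _ ≤ l⁻¹ * ε := by gcongr
      rw [← mul_assoc]
      refine le_trans ?_ hm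
      refine le_trans ?_ (mul_meas_ge_le_lintegral
        ((φ P).mono.measurable.comp (measurable_const.mul hf.nnnorm))
        ((n : ℝ≥0∞) * (φ P).toFun x))
      gcongr
      intro hω
      exact (hgrow n hn).trans ((φ P).mono (hlx.trans (mul_le_mul_right hω _)))
    have hz : (φ P).toFun x * μ {ω | ε ≤ ‖f ω‖₊} = 0 := by
      by_contra hne
      obtain ⟨n, hn⟩ := ENNReal.exists_nat_mul_gt hne (b := 1) ENNReal.one_ne_top
      rcases Nat.eq_zero_or_pos n with rfl | hn0
      · simp at hn
      · exact absurd (hb n hn0) (not_le.2 hn)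
    exact (mul_eq_zero.1 hz).resolve_left hpos.ne'
  have hall : ∀ᵐ ω ∂μ, ∀ n : ℕ, ¬ ((n + 1 : ℝ≥0)⁻¹ ≤ ‖f ω‖₊) := by
    rw [ae_all_iff]
    intro n
    rw [ae_iff]
    simpa using hnull (n + 1 : ℝ≥0)⁻¹ (by positivity)
  filter_upwards [hall] with ω hω
  by_contra hne
  obtain ⟨n, hn⟩ := exists_nat_one_div_lt (norm_pos_iff.2 hne)
  refine hω n ?_
  rw [← NNReal.coe_le_coe]
  push_cast
  simpa [one_div] using hn.le

variable (φ)

/-- The robust Orlicz space: classes of random variables with finite Luxemburg norm. -/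
noncomputable def space : Submodule ℝ ((qs 𝔓).Germ ℝ) where
  carrier := {X | X ∈ L0 𝔓 ∧ luxemburg φ X < ∞}
  zero_mem' := ⟨(L0 𝔓).zero_mem, by rw [luxemburg_zero]; exact ENNReal.zero_lt_top⟩
  add_mem' := by
    rintro X Y ⟨hX, hX'⟩ ⟨hY, hY'⟩
    exact ⟨(L0 𝔓).add_mem hX hY,
      (luxemburg_add_le hX hY).trans_lt (ENNReal.add_lt_top.2 ⟨hX', hY'⟩)⟩
  smul_mem' := by
    rintro c X ⟨hX, hX'⟩
    exact ⟨(L0 𝔓).smul_mem c hX,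
      (luxemburg_smul_le c X hX hX').trans_lt (ENNReal.mul_lt_top ENNReal.coe_lt_top hX')⟩

noncomputable instance instNorm : Norm (space φ) where
  norm X := (luxemburg φ (X : (qs 𝔓).Germ ℝ)).toReal

theorem norm_def (X : space φ) : ‖X‖ = (luxemburg φ (X : (qs 𝔓).Germ ℝ)).toReal := rfl

theorem norm_smul_le_aux (c : ℝ) (X : space φ) : ‖c • X‖ ≤ ‖c‖ * ‖X‖ := by
  have h := luxemburg_smul_le c _ X.2.1 X.2.2
  have h' := ENNReal.toReal_mono (ENNReal.mul_lt_top ENNReal.coe_lt_top X.2.2).ne h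
  rw [ENNReal.toReal_mul] at h'
  exact h'

theorem core : NormedSpace.Core ℝ (space φ) where
  norm_nonneg _ := ENNReal.toReal_nonneg
  norm_smul c X := by
    refine le_antisymm (norm_smul_le_aux φ c X) ?_
    rcases eq_or_ne c 0 with rfl | hc
    · rw [norm_zero, zero_mul]
      exact ENNReal.toReal_nonneg
    · have h := norm_smul_le_aux φ c⁻¹ (c • X)
      rw [inv_smul_smul₀ hc, norm_inv] at h
      have hc' : 0 < ‖c‖ := norm_pos_iff.2 hc
      calc ‖c‖ * ‖X‖ ≤ ‖c‖ * (‖c‖⁻¹ * ‖c • X‖) := by gcongr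
        _ = ‖c • X‖ := by field_simp
  norm_triangle X Y := by
    have h := luxemburg_add_le (φ := φ) X.2.1 Y.2.1
    have h' := ENNReal.toReal_mono (ENNReal.add_lt_top.2 ⟨X.2.2, Y.2.2⟩).ne h
    rw [ENNReal.toReal_add X.2.2.ne Y.2.2.ne] at h'
    exact h'
  norm_eq_zero_iff X := by
    refine ⟨fun h => ?_, fun h => ?_⟩
    · refine Subtype.ext (eq_zero_of_luxemburg (φ := φ) X.2.1 ?_)
      exact ((ENNReal.toReal_eq_zero_iff _).1 h).resolve_right X.2.2.ne
    · rw [h, norm_def]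
      simp [luxemburg_zero]

noncomputable instance instNormedAddCommGroup : NormedAddCommGroup (space φ) :=
  NormedAddCommGroup.ofCore (core φ)

noncomputable instance instNormedSpace : NormedSpace ℝ (space φ) :=
  NormedSpace.ofCore (core φ)

/-- For a subspace `V` of the robust Orlicz space, the set `ca(V)` of all finite signed measures
`μ ≪ 𝔓` such that each `X ∈ V` is `|μ|`-integrable and `V ∋ X ↦ ∫ X d|μ|` is continuous. -/
def ca (V : Submodule ℝ (space φ)) : Set (SignedMeasure Ω) :=
  {μ | (∀ N : Set Ω, MeasurableSet N →
          (∀ P ∈ 𝔓, (P : Measure Ω) N = 0) → μ.totalVariation N = 0) ∧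
        (∀ X ∈ V, ∀ f : Ω → ℝ, IsRep f (X : (qs 𝔓).Germ ℝ) → Integrable f μ.totalVariation) ∧
        ∃ l : V → ℝ, Continuous l ∧
          ∀ (X : V) (f : Ω → ℝ), IsRep f ((X : space φ) : (qs 𝔓).Germ ℝ) →
            l X = ∫ ω, f ω ∂μ.totalVariation}

end General

section Topological

variable {Ω : Type*} [TopologicalSpace Ω] [MeasurableSpace Ω]
  {𝔓 : Set (ProbabilityMeasure Ω)} (φ : 𝔓 → OrliczFunction)

/-- The subspace of the robust Orlicz space of the classes of bounded continuous functions. -/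
def Cb : Submodule ℝ (space φ) where
  carrier := {X | ∃ f : Ω →ᵇ ℝ, ((f : Ω → ℝ) : (qs 𝔓).Germ ℝ) = X}
  zero_mem' := ⟨0, rfl⟩
  add_mem' := by
    rintro X Y ⟨f, hf⟩ ⟨g, hg⟩
    exact ⟨f + g, by rw [BoundedContinuousFunction.coe_add, Germ.coe_add, hf, hg]; rfl⟩
  smul_mem' := by
    rintro c X ⟨f, hf⟩
    exact ⟨c • f, by rw [BoundedContinuousFunction.coe_smul]; exact congrArg (c • ·) hf⟩

/-- The norm closure of the bounded continuous functions in the robust Orlicz space. -/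
noncomputable def closureCb : Submodule ℝ (space φ) := (Cb φ).topologicalClosure

end Topological

end RobustOrlicz

/-! Let `C` be the closure of the bounded continuous functions in the robust Orlicz space. A signed
measure `ν` belongs to `ca C` exactly when `∫ |g| d|ν| ≤ K ‖g‖` for all bounded continuous `g`
(`mem_ca_closureCb_iff`), so `ca C` is a linear space on which integration takes values in `C*`
(`NormDominated.exists_dual`). The map is injective because signed measures on a metrizable space
are determined by the integrals of bounded continuous functions.

Everything else rests on one estimate. If bounded continuous functions `f n` decrease and
`∫ f n dP → 0` for each `P ∈ 𝔓`, then Dini's theorem on the compact set `𝔓` makes the convergence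
uniform in `P`, and convexity of the Orlicz functions together with finiteness of `phiMax` gives
`‖f n‖ → 0` (`tendsto_norm_ofBCF_zero`). No tightness of `𝔓` is needed, and `Ω` need not be Polish.
It has two consequences:

* A norm-dominated measure vanishes on `𝔓`-polar closed sets, hence on all `𝔓`-polar sets
  (`measure_eq_zero_of_polar`), so integrals of elements of `C` are well defined, and the norm bound
  extends to `C` by Fatou's lemma (`lintegral_enorm_le_of_mem_closureCb`).
* A continuous functional `L` on `C`, restricted to bounded continuous functions, splits into a
  difference of positive functionals that are bounded by `‖L‖ ‖f‖` for `f ≥ 0`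
  (`orderPosPart`). These tend to `0` along sequences decreasing pointwise to `0`, so that the
  Daniell–Stone theorem (`exists_measure_lintegral_eq`) represents them by finite measures
  `μ₁`, `μ₂`, and `L` is integration against `μ₁ - μ₂`, first on bounded continuous functions and
  then, by density, on `C`.
-/

namespace RobustOrlicz

/-! ### A Daniell–Stone theorem -/

section Daniell

variable {Ω : Type*} [TopologicalSpace Ω]

/-- A closed set `F` of a compact space that misses the image of a Lindelöf space is cut off by a
*sequence* of continuous functions: equal to `1` on `F`, decreasing to `0` along the image. Each
point of the image has a neighbourhood on which some Urysohn function vanishes; countably many of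
these suffice, and the partial products of the corresponding functions do the job. -/
theorem exists_antitone_eq_one_tendsto_zero [LindelofSpace Ω] {K : Type*} [TopologicalSpace K]
    [T2Space K] [CompactSpace K] {i : Ω → K} (hi : Continuous i) {F : Set K} (hF : IsClosed F)
    (hFi : ∀ ω, i ω ∉ F) :
    ∃ g : ℕ → C(K, ℝ≥0), Antitone g ∧ (∀ n, ∀ x ∈ F, g n x = 1) ∧
      ∀ ω, Tendsto (fun n => g n (i ω)) atTop (𝓝 0) := by
  have hU : ∀ ω, ∃ h : C(K, ℝ≥0), (∀ x ∈ F, h x = 1) ∧ (∀ x, h x ≤ 1) ∧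
      ∀ᶠ y in 𝓝 ω, h (i y) = 0 := by
    intro ω
    obtain ⟨C, hC, hCc, hCF⟩ :=
      exists_mem_nhds_isClosed_subset (hF.isOpen_compl.mem_nhds (hFi ω))
    obtain ⟨h, h0, h1, hI⟩ := exists_continuous_zero_one_of_isClosed hCc hF
      (Set.disjoint_left.2 fun x hx hx' => hCF hx hx')
    refine ⟨⟨fun x => (h x).toNNReal, by fun_prop⟩, fun x hx => ?_, fun x => ?_, ?_⟩
    · simp [h1 hx]
    · simpa using (hI x).2
    · filter_upwards [hi.continuousAt hC] with y hy
      simp [h0 hy]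
  choose h h1 hle h0 using hU
  obtain ⟨t, ht, htU⟩ := LindelofSpace.elim_nhds_subcover
    (fun ω => {y | h ω (i y) = 0}) h0
  rcases t.eq_empty_or_nonempty with rfl | hne
  · have : IsEmpty Ω := by
      rw [← Set.univ_eq_empty_iff, ← htU]; simp
    exact ⟨fun _ => 1, fun _ _ _ => le_rfl, fun _ _ _ => rfl, fun ω => isEmptyElim ω⟩
  obtain ⟨e, rfl⟩ := ht.exists_eq_range hne
  refine ⟨fun n => ∏ k ∈ Finset.range n, h (e k), antitone_nat_of_succ_le fun n x => ?_,
    fun n x hx => ?_, fun ω => ?_⟩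
  · rw [Finset.prod_range_succ]
    exact mul_le_of_le_one_right' (hle (e n) x)
  · rw [ContinuousMap.prod_apply]
    exact Finset.prod_eq_one fun k _ => h1 (e k) x hx
  · have hω : ω ∈ ⋃ x ∈ Set.range e, {y | h x (i y) = 0} := htU ▸ Set.mem_univ ω
    simp only [Set.mem_range, Set.iUnion_exists, Set.iUnion_iUnion_eq', Set.mem_iUnion,
      Set.mem_ofPred_eq] at hω
    obtain ⟨m, hm⟩ := hω
    refine tendsto_atTop_of_eventually_const (i₀ := m + 1) fun n hn => ?_
    rw [ContinuousMap.prod_apply]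
    exact Finset.prod_eq_zero (Finset.mem_range.2 hn) hm

/-- **Daniell–Stone theorem** for bounded continuous functions on a Lindelöf Tychonoff space. By the
Riesz–Markov–Kakutani theorem, `Λ` is integration against a regular measure `ν` on the Stone–Čech
compactification; continuity of `Λ` along sequences decreasing to `0` makes `Ω` a set of full outer
`ν`-measure, and the trace of `ν` on `Ω` represents `Λ`. -/
theorem exists_measure_lintegral_eq [LindelofSpace Ω] [T35Space Ω] [MeasurableSpace Ω]
    [BorelSpace Ω] (Λ : (Ω →ᵇ ℝ≥0) →ₗ[ℝ≥0] ℝ≥0)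
    (hΛ : ∀ f : ℕ → Ω →ᵇ ℝ≥0, (∀ ω, Antitone fun n => f n ω) →
      (∀ ω, Tendsto (fun n => f n ω) atTop (𝓝 0)) →
      Tendsto (fun n => Λ (f n)) atTop (𝓝 0)) :
    ∃ μ : Measure Ω, IsFiniteMeasure μ ∧ ∀ f : Ω →ᵇ ℝ≥0, ∫⁻ ω, f ω ∂μ = Λ f := by
  borelize (StoneCech Ω)
  let i : Ω → StoneCech Ω := stoneCechUnit
  have hi : Continuous i := continuous_stoneCechUnit
  let R : CompactlySupportedContinuousMap (StoneCech Ω) ℝ≥0 →ₗ[ℝ≥0] (Ω →ᵇ ℝ≥0) :=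
    { toFun f := (BoundedContinuousFunction.mkOfCompact f.toContinuousMap).compContinuous ⟨i, hi⟩
      map_add' f g := rfl
      map_smul' c f := rfl }
  let ν   := NNRealRMK.rieszMeasure (Λ.comp R)
  have hν (f) : ∫⁻ x, f x ∂ν = Λ (R f) := NNRealRMK.lintegral_rieszMeasure (Λ.comp R) f
  have : IsFiniteMeasure ν := inferInstance
  have hF : ∀ F, IsClosed F → (∀ ω, i ω ∉ F) → ν F = 0 := by
    intro F hF hFi
    obtain ⟨g, hg, hg1, hg0⟩ := exists_antitone_eq_one_tendsto_zero hi hF hFi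
    have hlim := hΛ (fun n => R (CompactlySupportedContinuousMap.continuousMapEquiv (g n)))
      (fun ω m n hmn => hg hmn (i ω)) hg0
    refine le_antisymm (ge_of_tendsto' (ENNReal.tendsto_coe.2 hlim) fun n => ?_) zero_le
    rw [← hν, ← lintegral_indicator_one hF.measurableSet]
    refine lintegral_mono fun x => ?_
    refine Set.indicator_le (s := F) (f := 1) (g := fun x => (g n x : ℝ≥0∞)) (fun x hx => ?_) x
    simp [hg1 n x hx]
  have hrange : ∀ B, MeasurableSet B → ν (B ∩ Set.range i) = ν B := by
    -- `Set.range i` need not be measurable; `ν (Set.range i)` is its outer measure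
    have hfull : ν (Set.range i) = ν Set.univ := by
      refine le_antisymm (measure_mono (Set.subset_univ _)) ?_
      rw [Set.measure_eq_iInf_isOpen (Set.range i)]
      refine le_iInf₂ fun U hU => le_iInf fun hUo => ?_
      have := hF Uᶜ hUo.isClosed_compl fun ω hω => hω (hU ⟨ω, rfl⟩)
      rw [← measure_add_measure_compl hUo.measurableSet, this, add_zero]
    intro B hB
    have h1 := measure_inter_add_sdiff (μ := ν) (Set.range i) hB
    have h2 := measure_add_measure_compl (μ := ν) hB
    have h3 : ν (Set.range i \ B) ≤ ν Bᶜ := measure_mono fun x hx => hx.2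
    have h4 : ν (Set.range i ∩ B) ≤ ν B := measure_mono Set.inter_subset_right
    rw [Set.inter_comm]
    refine le_antisymm h4 ?_
    rw [hfull, ← h2] at h1
    refine (ENNReal.add_le_add_iff_right (measure_ne_top ν Bᶜ)).1 ?_
    rw [← h1]
    gcongr
  have hms : ‹MeasurableSpace Ω› = (borel (StoneCech Ω)).comap i := by
    rw [‹BorelSpace Ω›.measurable_eq, ← borel_comap, ← isInducing_stoneCechUnit.eq_induced]
  let m : OuterMeasure Ω := OuterMeasure.comap i ν.toOuterMeasure
  have hm : ‹MeasurableSpace Ω› ≤ m.caratheodory := by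
    rw [hms]
    rintro _ ⟨B, hB, rfl⟩
    rw [OuterMeasure.isCaratheodory_iff]
    intro t
    change ν (i '' t) = ν (i '' (t ∩ i ⁻¹' B)) + ν (i '' (t \ i ⁻¹' B))
    rw [Set.image_inter_preimage, Set.image_sdiff_preimage]
    exact (measure_inter_add_sdiff (μ := ν) (i '' t) hB).symm
  let μ := m.toMeasure hm
  have hμ : μ.map i = ν := by
    ext B hB
    rw [Measure.map_apply hi.measurable hB, toMeasure_apply _ _ (hi.measurable hB)]
    change ν (i '' (i ⁻¹' B)) = ν B
    rw [Set.image_preimage_eq_inter_range, hrange B hB]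
  refine ⟨μ, ⟨?_⟩, fun f => ?_⟩
  · have h := measure_lt_top ν Set.univ
    rwa [← hμ, Measure.map_apply hi.measurable MeasurableSet.univ] at h
  · have hb : ∀ ω, f ω ∈ Set.Icc 0 (nndist f 0) := fun ω =>
      ⟨zero_le, BoundedContinuousFunction.NNReal.upper_bound f ω⟩
    have hfc : Continuous fun ω => (⟨f ω, hb ω⟩ : Set.Icc 0 (nndist f 0)) := by fun_prop
    let F : CompactlySupportedContinuousMap (StoneCech Ω) ℝ≥0 :=
      CompactlySupportedContinuousMap.continuousMapEquiv
        ⟨fun x => ((stoneCechExtend hfc x : Set.Icc 0 (nndist f 0)) : ℝ≥0),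
          continuous_subtype_val.comp (continuous_stoneCechExtend hfc)⟩
    have hF : R F = f := by
      ext ω
      change (((stoneCechExtend hfc (stoneCechUnit ω) : Set.Icc 0 (nndist f 0)) : ℝ≥0) : ℝ) =
        f ω
      rw [stoneCechExtend_stoneCechUnit]
    have h := hν F
    rw [hF, ← hμ, lintegral_map (by fun_prop) hi.measurable] at h
    rw [← h]
    refine lintegral_congr fun ω => ?_
    exact congrArg ((↑) : ℝ≥0 → ℝ≥0∞) (congrArg (fun g : Ω →ᵇ ℝ≥0 => g ω) hF).symm

end Daniell

/-! ### Decomposition of functionals on bounded continuous functions -/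

section OrderDual

variable {Ω : Type*} [TopologicalSpace Ω]

/-- The real-valued bounded continuous function underlying an `ℝ≥0`-valued one. -/
def toRealBCF (f : Ω →ᵇ ℝ≥0) : Ω →ᵇ ℝ :=
  BoundedContinuousFunction.comp ((↑) : ℝ≥0 → ℝ) isometry_subtype_coe.lipschitz f

theorem toRealBCF_nonneg (f : Ω →ᵇ ℝ≥0) : 0 ≤ toRealBCF f := fun ω => (f ω).2

theorem toRealBCF_nnrealPart {f : Ω →ᵇ ℝ} (hf : 0 ≤ f) : toRealBCF f.nnrealPart = f :=
  BoundedContinuousFunction.ext fun ω => Real.coe_toNNReal _ (hf ω)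

/-- The positive part of a linear functional `l` on bounded continuous functions, evaluated at
`f ≥ 0`: the supremum of `l` over the order interval `[0, f]`. It has a meaning only if `l` is
bounded above there, as `sSup` of an unbounded set of reals is `0`. -/
noncomputable def orderPosPart (l : (Ω →ᵇ ℝ) →ₗ[ℝ] ℝ) (f : Ω →ᵇ ℝ) : ℝ := sSup (l '' Set.Icc 0 f)

section

variable {l : (Ω →ᵇ ℝ) →ₗ[ℝ] ℝ} {f g : Ω →ᵇ ℝ}

theorem orderPosPart_nonneg (hl : BddAbove (l '' Set.Icc 0 f)) (hf : 0 ≤ f) :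
    0 ≤ orderPosPart l f :=
  le_csSup hl ⟨0, ⟨le_rfl, hf⟩, map_zero l⟩

open scoped Pointwise in
theorem orderPosPart_add (hlf : BddAbove (l '' Set.Icc 0 f)) (hlg : BddAbove (l '' Set.Icc 0 g))
    (hf : 0 ≤ f) (hg : 0 ≤ g) : orderPosPart l (f + g) = orderPosPart l f + orderPosPart l g := by
  have h : (l '' Set.Icc 0 (f + g)) = l '' Set.Icc 0 f + l '' Set.Icc 0 g := by
    rw [← Set.image_add]
    congr 1
    refine Set.Subset.antisymm (fun u hu => ?_) ?_
    · -- Riesz decomposition of `u ≤ f + g`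
      refine ⟨u ⊓ f, ⟨le_inf hu.1 hf, inf_le_right⟩, u - u ⊓ f,
        ⟨sub_nonneg.2 inf_le_left, ?_⟩, add_sub_cancel _ _⟩
      rw [sub_le_comm]
      exact le_inf (sub_le_self u hg) (sub_le_iff_le_add.2 hu.2)
    · rintro _ ⟨u, hu, v, hv, rfl⟩
      exact ⟨add_nonneg hu.1 hv.1, add_le_add hu.2 hv.2⟩
  rw [orderPosPart, h, csSup_add ((Set.nonempty_Icc.2 hf).image l) hlf
    ((Set.nonempty_Icc.2 hg).image l) hlg]
  rfl

open scoped Pointwise in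
theorem orderPosPart_smul {c : ℝ} (hc : 0 ≤ c) :
    orderPosPart l (c • f) = c * orderPosPart l f := by
  rcases hc.eq_or_lt with rfl | hc
  · simp [orderPosPart]
  have h : l '' Set.Icc 0 (c • f) = c • (l '' Set.Icc 0 f) := by
    rw [← Set.image_smul, Set.image_image]
    ext x
    constructor
    · rintro ⟨g, hg, rfl⟩
      refine ⟨c⁻¹ • g, ⟨fun ω => ?_, fun ω => ?_⟩, ?_⟩
      · exact mul_nonneg (inv_nonneg.2 hc.le) (hg.1 ω)
      · exact (inv_mul_le_iff₀ hc).2 (hg.2 ω)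
      · change c • l (c⁻¹ • g) = l g
        rw [map_smul, smul_inv_smul₀ hc.ne']
    · rintro ⟨g, hg, rfl⟩
      exact ⟨c • g, ⟨fun ω => mul_nonneg hc.le (hg.1 ω),
        fun ω => mul_le_mul_of_nonneg_left (hg.2 ω) hc.le⟩, map_smul l c g⟩
  rw [orderPosPart, h, Real.sSup_smul_of_nonneg hc.le]
  rfl

open scoped Pointwise in
theorem orderPosPart_sub_orderPosPart_neg (hlf : BddAbove ((-l) '' Set.Icc 0 f)) (hf : 0 ≤ f) :
    orderPosPart l f - orderPosPart (-l) f = l f := by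
  -- the reflection `g ↦ f - g` maps the order interval `[0, f]` onto itself
  have h : l '' Set.Icc 0 f = {l f} + (-l) '' Set.Icc 0 f := by
    ext x
    rw [Set.singleton_add, Set.image_image]
    constructor
    · rintro ⟨g, hg, rfl⟩
      exact ⟨f - g, ⟨sub_nonneg.2 hg.2, sub_le_self f hg.1⟩, by simp⟩
    · rintro ⟨g, hg, rfl⟩
      exact ⟨f - g, ⟨sub_nonneg.2 hg.2, sub_le_self f hg.1⟩, by simp [sub_eq_add_neg]⟩
  rw [orderPosPart, h, csSup_add (Set.singleton_nonempty _) bddAbove_singleton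
    ((Set.nonempty_Icc.2 hf).image _) hlf, csSup_singleton]
  exact add_sub_cancel_right _ _

end

variable [LindelofSpace Ω] [T35Space Ω] [MeasurableSpace Ω] [BorelSpace Ω]

/-- The positive part of a functional `l` is represented by a finite measure, provided that `l` is
bounded on `[0, f]` by some `p f`, where `p` tends to `0` along sequences decreasing to `0`. -/
theorem exists_measure_integral_eq_orderPosPart (l : (Ω →ᵇ ℝ) →ₗ[ℝ] ℝ) (p : (Ω →ᵇ ℝ) → ℝ)
    (hl : ∀ f g : Ω →ᵇ ℝ, 0 ≤ g → g ≤ f → l g ≤ p f)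
    (hp : ∀ f : ℕ → Ω →ᵇ ℝ, Antitone f → (∀ ω, Tendsto (fun n => f n ω) atTop (𝓝 0)) →
      Tendsto (fun n => p (f n)) atTop (𝓝 0)) :
    ∃ μ : Measure Ω, IsFiniteMeasure μ ∧ ∀ f : Ω →ᵇ ℝ, 0 ≤ f → ∫ ω, f ω ∂μ = orderPosPart l f := by
  have hb : ∀ f, BddAbove (l '' Set.Icc 0 f) := by
    rintro f
    exact ⟨p f, by rintro _ ⟨g, hg, rfl⟩; exact hl f g hg.1 hg.2⟩
  let Λ : (Ω →ᵇ ℝ≥0) →ₗ[ℝ≥0] ℝ≥0 :=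
    { toFun f := ⟨orderPosPart l (toRealBCF f), orderPosPart_nonneg (hb _) (toRealBCF_nonneg f)⟩
      map_add' f g := NNReal.eq <|
        orderPosPart_add (hb _) (hb _) (toRealBCF_nonneg f) (toRealBCF_nonneg g)
      map_smul' c f := NNReal.eq <| orderPosPart_smul (f := toRealBCF f) c.2 }
  obtain ⟨μ, hμ, h⟩ := exists_measure_lintegral_eq Λ fun f hf hf0 => by
    rw [← NNReal.tendsto_coe]
    refine squeeze_zero (fun n => NNReal.coe_nonneg _) (fun n => ?_)
      (hp (fun n => toRealBCF (f n)) (fun m n hmn ω => hf ω hmn)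
        fun ω => NNReal.tendsto_coe.2 (hf0 ω))
    refine csSup_le ⟨_, 0, ⟨le_rfl, toRealBCF_nonneg _⟩, rfl⟩ ?_
    rintro _ ⟨g, hg, rfl⟩
    exact hl _ g hg.1 hg.2
  refine ⟨μ, hμ, fun f hf => ?_⟩
  have h1 := (f.nnrealPart).toReal_lintegral_coe_eq_integral μ
  rw [h, ENNReal.coe_toReal] at h1
  have h2 : ((Λ f.nnrealPart : ℝ≥0) : ℝ) = orderPosPart l f := by
    change orderPosPart l (toRealBCF f.nnrealPart) = _
    rw [toRealBCF_nnrealPart hf]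
  rw [← h2, h1]
  exact integral_congr_ae (ae_of_all _ fun ω => (Real.coe_toNNReal _ (hf ω)).symm)

/-- Jordan-type decomposition: a functional `l` that is bounded on order intervals by `p`, where `p`
tends to `0` along sequences decreasing to `0`, is the difference of the integrals against two
finite measures, both of which are dominated by `p`. -/
theorem exists_measures_integral_sub_eq (l : (Ω →ᵇ ℝ) →ₗ[ℝ] ℝ) (p : (Ω →ᵇ ℝ) → ℝ)
    (hl : ∀ f g : Ω →ᵇ ℝ, 0 ≤ g → g ≤ f → |l g| ≤ p f)
    (hp : ∀ f : ℕ → Ω →ᵇ ℝ, Antitone f → (∀ ω, Tendsto (fun n => f n ω) atTop (𝓝 0)) →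
      Tendsto (fun n => p (f n)) atTop (𝓝 0)) :
    ∃ μ ν : Measure Ω, IsFiniteMeasure μ ∧ IsFiniteMeasure ν ∧
      (∀ f : Ω →ᵇ ℝ, ∫ ω, f ω ∂μ - ∫ ω, f ω ∂ν = l f) ∧
      ∀ f : Ω →ᵇ ℝ, 0 ≤ f → ∫ ω, f ω ∂μ ≤ p f ∧ ∫ ω, f ω ∂ν ≤ p f := by
  have hl1 : ∀ f g : Ω →ᵇ ℝ, 0 ≤ g → g ≤ f → l g ≤ p f := fun f g h0 h1 =>
    (le_abs_self _).trans (hl f g h0 h1)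
  have hl2 : ∀ f g : Ω →ᵇ ℝ, 0 ≤ g → g ≤ f → (-l) g ≤ p f := fun f g h0 h1 =>
    (neg_le_abs _).trans (hl f g h0 h1)
  obtain ⟨μ, hμ, h1⟩ := exists_measure_integral_eq_orderPosPart l p hl1 hp
  obtain ⟨ν, hν, h2⟩ := exists_measure_integral_eq_orderPosPart (-l) p hl2 hp
  refine ⟨μ, ν, hμ, hν, fun f => ?_, fun f hf => ⟨?_, ?_⟩⟩
  · have key : ∀ f : Ω →ᵇ ℝ, 0 ≤ f → ∫ ω, f ω ∂μ - ∫ ω, f ω ∂ν = l f := by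
      intro f hf
      rw [h1 f hf, h2 f hf]
      refine orderPosPart_sub_orderPosPart_neg ⟨p f, ?_⟩ hf
      · rintro _ ⟨g, hg, rfl⟩; exact hl2 f g hg.1 hg.2
    have hf : f = f⁺ - f⁻ := (posPart_sub_negPart f).symm
    have e1 := key f⁺ (posPart_nonneg _)
    have e2 := key f⁻ (negPart_nonneg _)
    have e3 : ∀ ω, f ω = f⁺ ω - f⁻ ω := fun ω => congrArg (fun g : Ω →ᵇ ℝ => g ω) hf
    have e4 : ∀ (m : Measure Ω) [IsFiniteMeasure m],
        ∫ ω, f ω ∂m = ∫ ω, f⁺ ω ∂m - ∫ ω, f⁻ ω ∂m := fun m _ => by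
      rw [← integral_sub (f⁺.integrable m) (f⁻.integrable m)]
      exact integral_congr_ae (ae_of_all _ e3)
    have e5 : l f = l f⁺ - l f⁻ := by rw [← map_sub, ← hf]
    rw [e4 μ, e4 ν, e5, ← e1, ← e2]
    ring
  · rw [h1 f hf]
    refine csSup_le ⟨_, 0, ⟨le_rfl, hf⟩, rfl⟩ ?_
    rintro _ ⟨g, hg, rfl⟩; exact hl1 f g hg.1 hg.2
  · rw [h2 f hf]
    refine csSup_le ⟨_, 0, ⟨le_rfl, hf⟩, rfl⟩ ?_
    rintro _ ⟨g, hg, rfl⟩; exact hl2 f g hg.1 hg.2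

end OrderDual

end RobustOrlicz

/-! ### Estimates for Orlicz functions and the Luxemburg norm -/

theorem OrliczFunction.map_mul_le (ψ : OrliczFunction) {t : ℝ≥0} (ht : t ≤ 1) (x : ℝ≥0) :
    ψ.toFun (t * x) ≤ t * ψ.toFun x := by
  have := ψ.convex.2 (Set.mem_univ x) (Set.mem_univ 0) zero_le zero_le
    (add_tsub_cancel_of_le ht)
  simpa only [smul_eq_mul, mul_zero, add_zero, ψ.map_zero, smul_zero, ENNReal.smul_def] using this

/-- Orlicz functions grow at least linearly, so that integrability of `ψ(|f|)` with respect
to a finite measure gives integrability of `|f|`. -/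
theorem OrliczFunction.exists_le_add_mul (ψ : OrliczFunction) :
    ∃ a b : ℝ≥0, ∀ x : ℝ≥0, (x : ℝ≥0∞) ≤ a + b * ψ.toFun x := by
  obtain ⟨x₁, hx₁, hpos⟩ := ψ.exists_pos
  -- `ψ x₁` may be infinite, hence the finite slope `a / x₁` with `0 < a < ψ x₁`
  obtain ⟨a, ha, hav⟩ := ENNReal.lt_iff_exists_nnreal_btwn.1 hpos
  have ha : 0 < a := by exact_mod_cast ha
  refine ⟨x₁, x₁ / a, fun x => ?_⟩
  rcases le_or_gt x x₁ with hx | hx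
  · exact (ENNReal.coe_le_coe.2 hx).trans le_self_add
  · have hx0 : 0 < x := hx₁.trans hx
    have h1 : (a : ℝ≥0∞) ≤ (x₁ / x : ℝ≥0) * ψ.toFun x := by
      refine hav.le.trans ?_
      have := ψ.map_mul_le ((div_le_one hx0).2 hx.le) x
      rwa [div_mul_cancel₀ _ hx0.ne'] at this
    calc (x : ℝ≥0∞) = (x / a : ℝ≥0) * a := by
          rw [← ENNReal.coe_mul, div_mul_cancel₀ _ ha.ne']
      _ ≤ (x / a : ℝ≥0) * ((x₁ / x : ℝ≥0) * ψ.toFun x) := by gcongr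
      _ = (x₁ / a : ℝ≥0) * ψ.toFun x := by
          rw [← mul_assoc, ← ENNReal.coe_mul]
          congr 2
          field_simp
      _ ≤ _ := le_add_self

namespace RobustOrlicz

section

variable {Ω : Type*} [MeasurableSpace Ω] {𝔓 : Set (ProbabilityMeasure Ω)}

theorem IsRep.add {f g : Ω → ℝ} {X Y : (qs 𝔓).Germ ℝ} (hf : IsRep f X) (hg : IsRep g Y) :
    IsRep (f + g) (X + Y) := ⟨hf.1.add hg.1, by rw [← hf.2, ← hg.2]; rfl⟩

theorem IsRep.smul {f : Ω → ℝ} {X : (qs 𝔓).Germ ℝ} (hf : IsRep f X) (c : ℝ) :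
    IsRep (c • f) (c • X) := ⟨hf.1.const_smul c, by rw [← hf.2]; rfl⟩

variable (φ : 𝔓 → OrliczFunction)

/-- For `|f| ≤ M`, convexity gives `φ_P(|f| / l) ≤ (|f| / M) φ_Max(M / l)`; thus the modular of
uniformly bounded functions is controlled by their `L¹(P)`-norms, uniformly in `P`. -/
theorem modular_le_of_bound (hdom : ∀ x : ℝ≥0, phiMax φ x < ∞) {f : Ω → ℝ} {M : ℝ≥0}
    (hM : 0 < M) (hf : ∀ ω, ‖f ω‖₊ ≤ M) (l : ℝ≥0) :
    modular φ l (f : (qs 𝔓).Germ ℝ) ≤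
      phiMax φ (l⁻¹ * M) * (M⁻¹ : ℝ≥0) *
        ⨆ P : 𝔓, ∫⁻ ω, ‖f ω‖ₑ ∂((P : ProbabilityMeasure Ω) : Measure Ω) := by
  rw [modular_coe, ENNReal.mul_iSup]
  refine iSup_mono fun P => ?_
  refine le_trans ?_ (lintegral_const_mul' _ _
    (ENNReal.mul_ne_top (hdom _).ne ENNReal.coe_ne_top)).le
  refine lintegral_mono fun ω => ?_
  have h := (φ P).map_mul_le (t := M⁻¹ * ‖f ω‖₊) (x := l⁻¹ * M)
    ((inv_mul_le_iff₀ hM).2 (by simpa using hf ω))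
  have e : M⁻¹ * ‖f ω‖₊ * (l⁻¹ * M) = l⁻¹ * ‖f ω‖₊ := by
    field_simp
  rw [e] at h
  refine h.trans ?_
  rw [mul_comm, ENNReal.coe_mul, ← mul_assoc]
  have : (φ P).toFun (l⁻¹ * M) ≤ phiMax φ (l⁻¹ * M) := le_iSup (fun P => (φ P).toFun (l⁻¹ * M)) P
  gcongr
  exact le_rfl

theorem luxemburg_mono {f g : Ω → ℝ} (h : ∀ ω, ‖f ω‖₊ ≤ ‖g ω‖₊) :
    luxemburg φ (f : (qs 𝔓).Germ ℝ) ≤ luxemburg φ (g : (qs 𝔓).Germ ℝ) := by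
  refine iInf_mono fun l => iInf_mono fun hl => iInf_mono' fun hm => ⟨le_trans ?_ hm, le_rfl⟩
  rw [modular_coe, modular_coe]
  exact iSup_mono fun P => lintegral_mono fun ω => (φ P).mono (by gcongr; exact h ω)

theorem luxemburg_lt_top_of_bound (hdom : ∀ x : ℝ≥0, phiMax φ x < ∞) {f : Ω → ℝ} {M : ℝ≥0}
    (hf : ∀ ω, ‖f ω‖₊ ≤ M) : luxemburg φ (f : (qs 𝔓).Germ ℝ) < ∞ := by
  wlog hM : 0 < M generalizing M
  · exact this (M := 1) (fun ω => (hf ω).trans ((not_lt.1 hM).trans zero_le_one)) one_pos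
  obtain ⟨A, hA⟩ : ∃ A : ℝ≥0, phiMax φ 1 = A := ⟨_, (ENNReal.coe_toNNReal (hdom 1).ne).symm⟩
  -- by convexity, `φ_Max t ≤ t * φ_Max 1 ≤ 1`
  let t : ℝ≥0 := (A + 1)⁻¹
  have ht : t ≤ 1 := inv_le_one_of_one_le₀ (by simp)
  have ht0 : 0 < t := by positivity
  have h1 : phiMax φ t ≤ 1 := by
    refine iSup_le fun P => ?_
    have h := (φ P).map_mul_le ht 1
    rw [mul_one] at h
    refine h.trans ?_
    have h2 : (φ P).toFun 1 ≤ A := (le_iSup (fun P => (φ P).toFun 1) P).trans hA.le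
    calc (t : ℝ≥0∞) * (φ P).toFun 1 ≤ t * A := by gcongr
      _ ≤ 1 := by
        rw [← ENNReal.coe_mul, ENNReal.coe_le_one_iff]
        rw [inv_mul_le_iff₀ (by positivity)]
        simp
  refine (luxemburg_le (l := M / t) (by positivity) ?_).trans_lt ENNReal.coe_lt_top
  refine (modular_le_of_bound φ hdom hM hf _).trans ?_
  have e : (M / t)⁻¹ * M = t := by field_simp
  have h2 : (⨆ P : 𝔓, ∫⁻ ω, ‖f ω‖ₑ ∂((P : ProbabilityMeasure Ω) : Measure Ω)) ≤ M := by
    refine iSup_le fun P => ?_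
    calc _ ≤ ∫⁻ ω, M ∂((P : ProbabilityMeasure Ω) : Measure Ω) :=
          lintegral_mono fun ω => ENNReal.coe_le_coe.2 (hf ω)
      _ = M := by simp
  rw [e, mul_assoc]
  calc _ ≤ 1 * (((M⁻¹ : ℝ≥0) : ℝ≥0∞) * M) := by gcongr
    _ = 1 := by rw [one_mul, ← ENNReal.coe_mul, inv_mul_cancel₀ hM.ne', ENNReal.coe_one]

/-- The robust Orlicz space embeds continuously into `L¹(P)` for every `P ∈ 𝔓`, though not uniformly
in `P`. -/
theorem exists_lintegral_enorm_le_luxemburg (P : 𝔓) :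
    ∃ c : ℝ≥0, ∀ f : Ω → ℝ, Measurable f →
      ∫⁻ ω, ‖f ω‖ₑ ∂((P : ProbabilityMeasure Ω) : Measure Ω) ≤
        c * luxemburg φ (f : (qs 𝔓).Germ ℝ) := by
  obtain ⟨a, b, hab⟩ := (φ P).exists_le_add_mul
  refine ⟨a + b + 1, fun f hf => ?_⟩
  have hc : ((a + b + 1 : ℝ≥0) : ℝ≥0∞) ≠ 0 := by simp
  rw [mul_comm, ← ENNReal.div_le_iff hc ENNReal.coe_ne_top]
  refine le_iInf fun l => le_iInf fun hl => le_iInf fun hm => ?_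
  rw [ENNReal.div_le_iff hc ENNReal.coe_ne_top]
  have hm' := (le_iSup _ P).trans ((modular_coe l f).symm.trans_le hm)
  calc ∫⁻ ω, ‖f ω‖ₑ ∂((P : ProbabilityMeasure Ω) : Measure Ω)
      ≤ ∫⁻ ω, l * (a + b * (φ P).toFun (l⁻¹ * ‖f ω‖₊))
          ∂((P : ProbabilityMeasure Ω) : Measure Ω) := by
        refine lintegral_mono fun ω => ?_
        calc ‖f ω‖ₑ = l * ((l⁻¹ * ‖f ω‖₊ : ℝ≥0) : ℝ≥0∞) := by
              rw [← ENNReal.coe_mul, mul_inv_cancel_left₀ hl.ne']; rfl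
          _ ≤ _ := by gcongr; exact hab _
    _ = l * (a + b * ∫⁻ ω, (φ P).toFun (l⁻¹ * ‖f ω‖₊)
          ∂((P : ProbabilityMeasure Ω) : Measure Ω)) := by
        have hmeas : Measurable fun ω => (φ P).toFun (l⁻¹ * ‖f ω‖₊) :=
          (φ P).mono.measurable.comp (measurable_const.mul hf.nnnorm)
        rw [lintegral_const_mul _ (by fun_prop), lintegral_add_left (by fun_prop),
          lintegral_const_mul _ hmeas]
        simp
    _ ≤ l * (a + b * 1) := by gcongr
    _ ≤ _ := by
        rw [mul_one]
        push_cast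
        exact mul_le_mul' le_rfl le_self_add

end

/-! ### Bounded continuous functions in the robust Orlicz space -/

section BoundedContinuous

variable {Ω : Type*} [TopologicalSpace Ω] [MeasurableSpace Ω] [OpensMeasurableSpace Ω]
  {𝔓 : Set (ProbabilityMeasure Ω)} (φ : 𝔓 → OrliczFunction)
  (hdom : ∀ x : ℝ≥0, phiMax φ x < ∞)

/-- The class of a bounded continuous function, as an element of the closure of `Cb φ`. -/
noncomputable def ofBCF (hdom : ∀ x : ℝ≥0, phiMax φ x < ∞) : (Ω →ᵇ ℝ) →ₗ[ℝ] closureCb φ where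
  toFun f := ⟨⟨((f : Ω → ℝ) : (qs 𝔓).Germ ℝ), ⟨f, f.continuous.measurable, rfl⟩,
    luxemburg_lt_top_of_bound φ hdom fun ω => f.nnnorm_coe_le_nnnorm ω⟩,
    subset_closure ⟨f, rfl⟩⟩
  map_add' _ _ := rfl
  map_smul' _ _ := rfl

variable {φ}

theorem isRep_ofBCF (f : Ω →ᵇ ℝ) :
    IsRep f ((ofBCF φ hdom f : space φ) : (qs 𝔓).Germ ℝ) := ⟨f.continuous.measurable, rfl⟩

theorem denseRange_ofBCF : DenseRange (ofBCF φ hdom) := by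
  refine Metric.denseRange_iff.2 fun X r hr => ?_
  obtain ⟨Y, ⟨g, hg⟩, hY⟩ := Metric.mem_closure_iff.1 X.2 r hr
  have e : ((ofBCF φ hdom g : closureCb φ) : space φ) = Y := Subtype.ext hg
  exact ⟨g, by rw [← e] at hY; exact hY⟩

theorem norm_ofBCF_mono {f g : Ω →ᵇ ℝ} (h : ∀ ω, ‖f ω‖ ≤ ‖g ω‖) :
    ‖ofBCF φ hdom f‖ ≤ ‖ofBCF φ hdom g‖ :=
  ENNReal.toReal_mono (ofBCF φ hdom g).1.2.2.ne (luxemburg_mono φ h)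

/-- The compactness of `𝔓` enters here: if the integrals of a decreasing sequence of bounded
continuous functions tend to `0` for each `P ∈ 𝔓`, they do so uniformly in `P` by Dini's theorem,
and `modular_le_of_bound` turns this into convergence in norm. -/
theorem tendsto_norm_ofBCF_zero (hcompact : IsCompact 𝔓) {f : ℕ → Ω →ᵇ ℝ}
    (hanti : Antitone f) (hnonneg : ∀ n, 0 ≤ f n)
    (hlim : ∀ P ∈ 𝔓, Tendsto (fun n => ∫ ω, f n ω ∂(P : Measure Ω)) atTop (𝓝 0)) :
    Tendsto (fun n => ‖ofBCF φ hdom (f n)‖) atTop (𝓝 0) := by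
  have hunif : TendstoUniformlyOn
      (fun n (P : ProbabilityMeasure Ω) => ∫ ω, f n ω ∂(P : Measure Ω)) (fun _ => 0) atTop 𝔓 := by
    refine Antitone.tendstoUniformlyOn_of_forall_tendsto hcompact (fun n => ?_)
      (fun P _ m n hmn => ?_) continuousOn_const hlim
    · exact (ProbabilityMeasure.continuous_integral_boundedContinuousFunction (f n)).continuousOn
    · exact integral_mono ((f n).integrable _) ((f m).integrable _) (hanti hmn)
  have hpos : ∀ n ω, (0 : ℝ) ≤ f n ω := fun n ω => hnonneg n ω
  rw [Metric.tendsto_atTop]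
  intro ε hε
  lift ε to ℝ≥0 using hε.le
  replace hε : 0 < ε := by exact_mod_cast hε
  let M : ℝ≥0 := ‖f 0‖₊ + 1
  have hM : 0 < M := by positivity
  have hfM : ∀ n ω, ‖f n ω‖₊ ≤ M := fun n ω => by
    have h1 : ‖f n ω‖ ≤ ‖f 0 ω‖ := by
      rw [Real.norm_of_nonneg (hpos n ω), Real.norm_of_nonneg (hpos 0 ω)]
      exact hanti (Nat.zero_le n) ω
    exact (show ‖f n ω‖₊ ≤ ‖f 0 ω‖₊ from h1).trans
      (((f 0).nnnorm_coe_le_nnnorm ω).trans le_self_add)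
  obtain ⟨A, hA⟩ : ∃ A : ℝ≥0, phiMax φ ((ε / 2)⁻¹ * M) = A :=
    ⟨_, (ENNReal.coe_toNNReal (hdom _).ne).symm⟩
  have hδ : 0 < M / (A + 1) := by positivity
  obtain ⟨N, hN⟩ := eventually_atTop.1 (Metric.tendstoUniformlyOn_iff.1 hunif _ hδ)
  refine ⟨N, fun n hn => ?_⟩
  have hmod : modular φ (ε / 2) ((f n : Ω → ℝ) : (qs 𝔓).Germ ℝ) ≤ 1 := by
    refine (modular_le_of_bound φ hdom hM (hfM n) _).trans ?_
    have hsup : (⨆ P : 𝔓, ∫⁻ ω, ‖f n ω‖ₑ ∂((P : ProbabilityMeasure Ω) : Measure Ω)) ≤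
        (M / (A + 1) : ℝ≥0) := by
      refine iSup_le fun P => ?_
      have h := hN n hn P P.2
      rw [dist_zero_left, Real.norm_eq_abs] at h
      rw [← ofReal_integral_norm_eq_lintegral_enorm ((f n).integrable _), ENNReal.ofReal_le_coe]
      · refine le_trans (le_of_eq ?_) ((le_abs_self _).trans h.le)
        exact integral_congr_ae (ae_of_all _ fun ω => Real.norm_of_nonneg (hpos n ω))
    rw [hA]
    calc _ ≤ (A : ℝ≥0∞) * (M⁻¹ : ℝ≥0) * (M / (A + 1) : ℝ≥0) := by gcongr
      _ ≤ 1 := by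
        rw [← ENNReal.coe_mul, ← ENNReal.coe_mul, ENNReal.coe_le_one_iff]
        have e : A * M⁻¹ * (M / (A + 1)) = A / (A + 1) := by field_simp
        rw [e]
        exact div_le_one_of_le₀ le_self_add zero_le
  have hle : ‖ofBCF φ hdom (f n)‖ ≤ (ε / 2 : ℝ≥0) :=
    ENNReal.toReal_le_coe_of_le_coe (luxemburg_le (by positivity) hmod)
  rw [dist_zero_right, norm_norm]
  refine hle.trans_lt ?_
  exact NNReal.coe_lt_coe.2 (NNReal.half_lt_self hε.ne')

end BoundedContinuous

section Fatou

variable {Ω : Type*} [TopologicalSpace Ω] [MeasurableSpace Ω] [OpensMeasurableSpace Ω]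
  {𝔓 : Set (ProbabilityMeasure Ω)} {φ : 𝔓 → OrliczFunction}
  (hdom : ∀ x : ℝ≥0, phiMax φ x < ∞)

/-- A bound of `∫ |g| dμ` by the norm passes from bounded continuous functions to their closure. As
a class in the closure is only determined up to `𝔓`-polar sets, `μ` has to vanish on these; the bound
then follows from Fatou's lemma along an approximating sequence that converges quasi-surely. -/
theorem lintegral_enorm_le_of_mem_closureCb {μ : Measure Ω}
    (hμ : ∀ N : Set Ω, MeasurableSet N → (∀ P ∈ 𝔓, (P : Measure Ω) N = 0) → μ N = 0)
    {K : ℝ} (hK : ∀ g : Ω →ᵇ ℝ, ∫⁻ ω, ‖g ω‖ₑ ∂μ ≤ ENNReal.ofReal (K * ‖ofBCF φ hdom g‖))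
    (X : closureCb φ) {f : Ω → ℝ} (hf : IsRep f ((X : space φ) : (qs 𝔓).Germ ℝ)) :
    ∫⁻ ω, ‖f ω‖ₑ ∂μ ≤ ENNReal.ofReal (K * ‖X‖) := by
  have hex : ∀ n : ℕ, ∃ g : Ω →ᵇ ℝ, ‖ofBCF φ hdom g - X‖ < (1 / 2) ^ n := by
    intro n
    obtain ⟨g, hg⟩ := Metric.denseRange_iff.1 (denseRange_ofBCF hdom) X ((1 / 2) ^ n)
      (by positivity)
    exact ⟨g, by rwa [dist_comm, dist_eq_norm] at hg⟩
  choose g hg using hex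
  -- a fast approximating sequence converges outside a set that is null for every `P ∈ 𝔓`
  have hqs : ∀ P ∈ 𝔓, ∀ᵐ ω ∂(P : Measure Ω), Tendsto (fun n => g n ω) atTop (𝓝 (f ω)) := by
    intro P hP
    obtain ⟨c, hc⟩ := exists_lintegral_enorm_le_luxemburg φ ⟨P, hP⟩
    have hmeas : ∀ n, Measurable fun ω => g n ω - f ω := fun n =>
      (g n).continuous.measurable.sub hf.1
    have hn : ∀ n, ∫⁻ ω, ‖g n ω - f ω‖ₑ ∂(P : Measure Ω) ≤ c * ENNReal.ofReal ((1 / 2) ^ n) := by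
      intro n
      refine (hc _ (hmeas n)).trans ?_
      gcongr
      have h1 : luxemburg φ ((fun ω => g n ω - f ω : Ω → ℝ) : (qs 𝔓).Germ ℝ) =
          luxemburg φ ((ofBCF φ hdom (g n) - X : closureCb φ) : space φ).1 := by
        congr 1
        change ((g n : Ω → ℝ) : (qs 𝔓).Germ ℝ) - (f : (qs 𝔓).Germ ℝ) = _
        rw [hf.2]
        rfl
      rw [h1]
      refine (ENNReal.le_ofReal_iff_toReal_le
        ((ofBCF φ hdom (g n) - X : closureCb φ) : space φ).2.2.ne (by positivity)).2 (hg n).le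
    have hsum : ∫⁻ ω, ∑' n, ‖g n ω - f ω‖ₑ ∂(P : Measure Ω) ≠ ∞ := by
      rw [lintegral_tsum fun n => (hmeas n).enorm.aemeasurable]
      refine ne_top_of_le_ne_top ?_ (ENNReal.tsum_le_tsum hn)
      rw [ENNReal.tsum_mul_left, ← ENNReal.ofReal_tsum_of_nonneg (fun n => by positivity)
        summable_geometric_two]
      exact ENNReal.mul_ne_top ENNReal.coe_ne_top ENNReal.ofReal_ne_top
    filter_upwards [ae_lt_top (Measurable.tsum fun n => (hmeas n).enorm) hsum] with ω hω
    have h0 := ENNReal.tendsto_atTop_zero_of_tsum_ne_top hω.ne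
    rw [tendsto_iff_edist_tendsto_0]
    simpa only [edist_eq_enorm_sub] using h0
  have hae : ∀ᵐ ω ∂μ, Tendsto (fun n => g n ω) atTop (𝓝 (f ω)) :=
    hμ _ (measurableSet_tendsto_fun (fun n => (g n).continuous.measurable) hf.1).compl hqs
  calc ∫⁻ ω, ‖f ω‖ₑ ∂μ = ∫⁻ ω, liminf (fun n => ‖g n ω‖ₑ) atTop ∂μ :=
        lintegral_congr_ae (hae.mono fun ω hω => hω.enorm.liminf_eq.symm)
    _ ≤ liminf (fun n => ∫⁻ ω, ‖g n ω‖ₑ ∂μ) atTop :=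
        lintegral_liminf_le fun n => (g n).continuous.measurable.enorm
    _ ≤ liminf (fun n => ENNReal.ofReal (K * ‖ofBCF φ hdom (g n)‖)) atTop :=
        liminf_le_liminf (Eventually.of_forall fun n => hK (g n))
    _ = ENNReal.ofReal (K * ‖X‖) := by
        have hlim : Tendsto (fun n => ofBCF φ hdom (g n)) atTop (𝓝 X) := by
          rw [tendsto_iff_norm_sub_tendsto_zero]
          exact squeeze_zero (fun n => norm_nonneg _) (fun n => (hg n).le)
            (tendsto_pow_atTop_nhds_zero_of_lt_one (by norm_num) (by norm_num))
        exact (ENNReal.tendsto_ofReal (hlim.norm.const_mul K)).liminf_eq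

end Fatou

section Polar

variable {Ω : Type*} [TopologicalSpace Ω] [TopologicalSpace.PseudoMetrizableSpace Ω]
  [MeasurableSpace Ω] [BorelSpace Ω]
  {𝔓 : Set (ProbabilityMeasure Ω)} {φ : 𝔓 → OrliczFunction}
  (hdom : ∀ x : ℝ≥0, phiMax φ x < ∞)

/-- A finite measure for which `∫ |g| dμ` is bounded by the norm of `g` vanishes on `𝔓`-polar sets.
By inner regularity this reduces to closed polar sets, which are decreasing limits of thickened
indicators, and those converge to `0` in norm. -/
theorem measure_eq_zero_of_polar (hcompact : IsCompact 𝔓) {μ : Measure Ω} [IsFiniteMeasure μ]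
    {K : ℝ} (hK : ∀ g : Ω →ᵇ ℝ, ∫⁻ ω, ‖g ω‖ₑ ∂μ ≤ ENNReal.ofReal (K * ‖ofBCF φ hdom g‖))
    {N : Set Ω} (hN : MeasurableSet N) (hN0 : ∀ P ∈ 𝔓, (P : Measure Ω) N = 0) : μ N = 0 := by
  let := TopologicalSpace.pseudoMetrizableSpacePseudoMetric Ω
  rw [hN.measure_eq_iSup_isClosed_of_ne_top (measure_ne_top μ N)]
  simp only [ENNReal.iSup_eq_zero]
  intro F hFN hF
  let δ : ℕ → ℝ := fun n => 1 / (n + 1)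
  have hδ : ∀ n, 0 < δ n := fun n => Nat.one_div_pos_of_nat
  have hδ0 : Tendsto δ atTop (𝓝 0) := tendsto_one_div_add_atTop_nhds_zero_nat
  let g : ℕ → Ω →ᵇ ℝ := fun n => toRealBCF (thickenedIndicator (hδ n) F)
  have hlim : Tendsto (fun n => ‖ofBCF φ hdom (g n)‖) atTop (𝓝 0) := by
    refine tendsto_norm_ofBCF_zero hdom hcompact (fun m n hmn ω => ?_)
      (fun n => toRealBCF_nonneg _) fun P hP => ?_
    · exact NNReal.coe_le_coe.2 (thickenedIndicator_mono (hδ n) (hδ m)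
        (one_div_le_one_div_of_le (by positivity) (by gcongr)) F ω)
    · have h := tendsto_integral_thickenedIndicator_of_isClosed (P : Measure Ω) hF hδ hδ0
      rwa [measureReal_def, measure_mono_null hFN (hN0 P hP), ENNReal.toReal_zero] at h
  have hlim' : Tendsto (fun n => ENNReal.ofReal (K * ‖ofBCF φ hdom (g n)‖)) atTop (𝓝 0) := by
    simpa using ENNReal.tendsto_ofReal (hlim.const_mul K)
  refine le_antisymm (ge_of_tendsto' hlim' fun n => le_trans ?_ (hK (g n))) zero_le
  rw [← lintegral_indicator_one hF.measurableSet]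
  refine lintegral_mono fun ω => ?_
  refine Set.indicator_le (s := F) (f := 1) (g := fun ω => ‖g n ω‖ₑ) (fun x hx => ?_) ω
  have : g n x = 1 := by
    change ((thickenedIndicator (hδ n) F x : ℝ≥0) : ℝ) = 1
    rw [thickenedIndicator_one (hδ n) F hx, NNReal.coe_one]
  simp [this]

end Polar

/-! ### Representation of the dual space -/

section Integral

variable {Ω : Type*} [MeasurableSpace Ω]

theorem integral_toSignedMeasure_sub {μ ν : Measure Ω} [IsFiniteMeasure μ] [IsFiniteMeasure ν]
    {f : Ω → ℝ} (hμ : Integrable f μ) (hν : Integrable f ν) :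
    ∫ᵛ ω, f ω ∂<•(μ.toSignedMeasure - ν.toSignedMeasure) = ∫ ω, f ω ∂μ - ∫ ω, f ω ∂ν := by
  rw [VectorMeasure.integral_sub_vectorMeasure, VectorMeasure.integral_toSignedMeasure,
    VectorMeasure.integral_toSignedMeasure]
  · rwa [VectorMeasure.Integrable, Measure.variation_toSignedMeasure]
  · rwa [VectorMeasure.Integrable, Measure.variation_toSignedMeasure]

/-- A signed measure is determined by its integrals of bounded continuous functions: if these all
vanish, the two Jordan parts integrate bounded continuous functions equally, so they coincide. -/
theorem eq_of_forall_integral_boundedContinuousFunction_eq [TopologicalSpace Ω]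
    [HasOuterApproxClosed Ω] [BorelSpace Ω] {μ ν : SignedMeasure Ω}
    (h : ∀ g : Ω →ᵇ ℝ, ∫ᵛ ω, g ω ∂<•μ = ∫ᵛ ω, g ω ∂<•ν) : μ = ν := by
  have hint : ∀ (η : SignedMeasure Ω) (g : Ω →ᵇ ℝ), η.Integrable g := fun η g => by
    rw [VectorMeasure.Integrable, ← SignedMeasure.totalVariation_eq_variation]
    exact g.integrable _
  set η := μ - ν with hη
  have hη' : η = η.toJordanDecomposition.posPart.toSignedMeasure -
      η.toJordanDecomposition.negPart.toSignedMeasure :=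
    η.toSignedMeasure_toJordanDecomposition.symm
  have heq : η.toJordanDecomposition.posPart = η.toJordanDecomposition.negPart := by
    refine ext_of_forall_integral_eq_of_IsFiniteMeasure fun g => sub_eq_zero.1 ?_
    rw [← integral_toSignedMeasure_sub (g.integrable _) (g.integrable _), ← hη', hη,
      VectorMeasure.integral_sub_vectorMeasure (hint μ g) (hint ν g), h g, sub_self]
  rw [← sub_eq_zero, ← hη, hη']
  simp [heq]

end Integral

section Dual

theorem exists_isRep {Ω : Type*} [TopologicalSpace Ω] [MeasurableSpace Ω]
    {𝔓 : Set (ProbabilityMeasure Ω)} {φ : 𝔓 → OrliczFunction} (X : closureCb φ) :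
    ∃ f : Ω → ℝ, IsRep f ((X : space φ) : (qs 𝔓).Germ ℝ) := X.1.2.1

variable {Ω : Type*} [TopologicalSpace Ω] [MeasurableSpace Ω] [BorelSpace Ω]
  {𝔓 : Set (ProbabilityMeasure Ω)} {φ : 𝔓 → OrliczFunction}
  (hdom : ∀ x : ℝ≥0, phiMax φ x < ∞)

/-- A measure `μ` is norm-dominated if `∫ |g| dμ` is bounded by a multiple of the robust Luxemburg
norm of `g`, for bounded continuous `g`. For signed measures, norm-domination of the total variation
characterizes membership in `ca` of the closure (`mem_ca_closureCb_iff`). The constant `K` may be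
any real number, as `ENNReal.ofReal` truncates negative values to `0`. -/
def NormDominated (μ : Measure Ω) : Prop :=
  ∃ K : ℝ, ∀ g : Ω →ᵇ ℝ, ∫⁻ ω, ‖g ω‖ₑ ∂μ ≤ ENNReal.ofReal (K * ‖ofBCF φ hdom g‖)

variable {hdom}

theorem NormDominated.mono {μ ν : Measure Ω} (h : NormDominated hdom μ) (hνμ : ν ≤ μ) :
    NormDominated hdom ν := by
  obtain ⟨K, hK⟩ := h
  exact ⟨K, fun g => (lintegral_mono' hνμ le_rfl).trans (hK g)⟩

theorem NormDominated.add {μ ν : Measure Ω} (hμ : NormDominated hdom μ)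
    (hν : NormDominated hdom ν) : NormDominated hdom (μ + ν) := by
  obtain ⟨K, hK⟩ := hμ
  obtain ⟨K', hK'⟩ := hν
  refine ⟨|K| + |K'|, fun g => ?_⟩
  rw [lintegral_add_measure, add_mul, ENNReal.ofReal_add (by positivity) (by positivity)]
  refine add_le_add ((hK g).trans ?_) ((hK' g).trans ?_)
  · gcongr; exact le_abs_self K
  · gcongr; exact le_abs_self K'

theorem NormDominated.smul {μ : Measure Ω} (h : NormDominated hdom μ) (c : ℝ≥0) :
    NormDominated hdom (c • μ) := by
  obtain ⟨K, hK⟩ := h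
  refine ⟨c * K, fun g => ?_⟩
  rw [lintegral_smul_measure, mul_assoc, ENNReal.ofReal_mul c.coe_nonneg,
    ENNReal.ofReal_coe_nnreal, ENNReal.smul_def, smul_eq_mul]
  gcongr
  exact hK g

variable [TopologicalSpace.PseudoMetrizableSpace Ω]

theorem NormDominated.ae_eq (hcompact : IsCompact 𝔓) {μ : Measure Ω} [IsFiniteMeasure μ]
    (h : NormDominated hdom μ) {X : (qs 𝔓).Germ ℝ} {f g : Ω → ℝ} (hf : IsRep f X)
    (hg : IsRep g X) : f =ᵐ[μ] g := by
  obtain ⟨K, hK⟩ := h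
  exact measure_eq_zero_of_polar hdom hcompact hK (measurableSet_eq_fun hf.1 hg.1).compl
    fun P hP => eventuallyEq_qs.1 (Germ.coe_eq.1 (hf.2.trans hg.2.symm)) ⟨P, hP⟩

theorem NormDominated.exists_lintegral_le (hcompact : IsCompact 𝔓) {μ : Measure Ω}
    [IsFiniteMeasure μ] (h : NormDominated hdom μ) :
    ∃ K : ℝ, ∀ (X : closureCb φ) (f : Ω → ℝ), IsRep f ((X : space φ) : (qs 𝔓).Germ ℝ) →
      ∫⁻ ω, ‖f ω‖ₑ ∂μ ≤ ENNReal.ofReal (K * ‖X‖) := by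
  obtain ⟨K, hK⟩ := h
  exact ⟨K, fun X f hf => lintegral_enorm_le_of_mem_closureCb hdom
    (fun N hN hN0 => measure_eq_zero_of_polar hdom hcompact hK hN hN0) hK X hf⟩

theorem NormDominated.integrable (hcompact : IsCompact 𝔓) {μ : Measure Ω}
    [IsFiniteMeasure μ] (h : NormDominated hdom μ) {X : closureCb φ} {f : Ω → ℝ}
    (hf : IsRep f ((X : space φ) : (qs 𝔓).Germ ℝ)) : Integrable f μ := by
  obtain ⟨K, hK⟩ := h.exists_lintegral_le hcompact
  exact ⟨hf.1.aestronglyMeasurable, (hK X f hf).trans_lt ENNReal.ofReal_lt_top⟩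

/-- If the total variation of `ν` is norm-dominated, integration against `ν` is a continuous linear
functional on the closure of the bounded continuous functions. -/
theorem NormDominated.exists_dual (hcompact : IsCompact 𝔓) {ν : SignedMeasure Ω}
    (h : NormDominated hdom ν.totalVariation) :
    ∃ L : StrongDual ℝ (closureCb φ), ∀ (X : closureCb φ) (f : Ω → ℝ),
      IsRep f ((X : space φ) : (qs 𝔓).Germ ℝ) → L X = ∫ᵛ ω, f ω ∂<•ν := by
  choose r hr using exists_isRep (φ := φ)
  have hcongr : ∀ (X : closureCb φ) (f : Ω → ℝ), IsRep f ((X : space φ) : (qs 𝔓).Germ ℝ) →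
      ∫ᵛ ω, r X ω ∂<•ν = ∫ᵛ ω, f ω ∂<•ν := fun X f hf =>
    VectorMeasure.integral_congr_ae (by
      rw [← SignedMeasure.totalVariation_eq_variation]
      exact h.ae_eq hcompact (hr X) hf)
  have hint : ∀ X, ν.Integrable (r X) := fun X => by
    rw [VectorMeasure.Integrable, ← SignedMeasure.totalVariation_eq_variation]
    exact h.integrable hcompact (hr X)
  obtain ⟨K, hK⟩ := h.exists_lintegral_le hcompact
  let L : closureCb φ →ₗ[ℝ] ℝ :=
    { toFun X := ∫ᵛ ω, r X ω ∂<•ν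
      map_add' X Y := by
        rw [hcongr (X + Y) (r X + r Y) ((hr X).add (hr Y))]
        exact VectorMeasure.integral_add (hint X) (hint Y)
      map_smul' c X := by
        rw [hcongr (c • X) (c • r X) ((hr X).smul c)]
        exact VectorMeasure.integral_smul _ _ _ c }
  let B := (ContinuousLinearMap.lsmul ℝ ℝ : ℝ →L[ℝ] ℝ →L[ℝ] ℝ).flip
  refine ⟨L.mkContinuous (‖B‖ * |K|) fun X => ?_, fun X f hf => hcongr X f hf⟩
  refine VectorMeasure.norm_integral_le_lintegral_norm.trans ?_
  rw [mul_assoc]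
  refine mul_le_mul_of_nonneg_left ?_ (ContinuousLinearMap.opNorm_nonneg _)
  refine ENNReal.toReal_le_of_le_ofReal (by positivity) ?_
  simp only [ofReal_norm]
  rw [← SignedMeasure.totalVariation_eq_variation]
  refine (hK X _ (hr X)).trans (ENNReal.ofReal_le_ofReal ?_)
  gcongr
  exact le_abs_self K

/-- Absolute continuity with respect to `𝔓` and integrability of the members of the closure, which
are part of the definition of `ca`, follow from the norm bound on bounded continuous functions. -/
theorem mem_ca_closureCb_iff (hcompact : IsCompact 𝔓) {ν : SignedMeasure Ω} :
    ν ∈ ca φ (closureCb φ) ↔ NormDominated hdom ν.totalVariation := by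
  refine ⟨fun ⟨_, hint, l, hl, hli⟩ => ?_, fun h => ⟨?_, ?_, ?_⟩⟩
  · let L : StrongDual ℝ (closureCb φ) :=
      { toFun := l
        map_add' X Y := by
          obtain ⟨f, hf⟩ := exists_isRep X
          obtain ⟨g, hg⟩ := exists_isRep Y
          rw [hli (X + Y) (f + g) (hf.add hg), hli X f hf, hli Y g hg]
          exact integral_add (hint _ X.2 f hf) (hint _ Y.2 g hg)
        map_smul' c X := by
          obtain ⟨f, hf⟩ := exists_isRep X
          rw [hli (c • X) (c • f) (hf.smul c), hli X f hf]
          exact integral_const_mul c f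
        cont := hl }
    refine ⟨‖L‖, fun g => ?_⟩
    have habs : ∀ ω, |g| ω = ‖g ω‖ := fun ω => rfl
    calc ∫⁻ ω, ‖g ω‖ₑ ∂ν.totalVariation = ENNReal.ofReal (∫ ω, ‖g ω‖ ∂ν.totalVariation) :=
          (ofReal_integral_norm_eq_lintegral_enorm (g.integrable _)).symm
      _ = ENNReal.ofReal (L (ofBCF φ hdom |g|)) :=
          congrArg _ (hli _ _ (isRep_ofBCF hdom |g|)).symm
      _ ≤ ENNReal.ofReal (‖L‖ * ‖ofBCF φ hdom g‖) := by
          refine ENNReal.ofReal_le_ofReal ((le_abs_self _).trans ((L.le_opNorm _).trans ?_))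
          gcongr
          exact norm_ofBCF_mono hdom fun ω => by rw [habs, norm_norm]
  · obtain ⟨K, hK⟩ := h
    exact fun N hN hN0 => measure_eq_zero_of_polar hdom hcompact hK hN hN0
  · exact fun X hX f hf => h.integrable hcompact (X := ⟨X, hX⟩) hf
  -- continuity of integration against `|ν|`: apply `exists_dual` to `|ν|` as a signed measure
  · have htv : ν.totalVariation.toSignedMeasure.totalVariation = ν.totalVariation := by
      rw [SignedMeasure.totalVariation_eq_variation, Measure.variation_toSignedMeasure]
    obtain ⟨L, hL⟩ := NormDominated.exists_dual (ν := ν.totalVariation.toSignedMeasure)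
      hcompact (htv.symm ▸ h)
    exact ⟨L, L.continuous, fun X f hf => (hL X f hf).trans VectorMeasure.integral_toSignedMeasure⟩

end Dual

section Surjective

variable {Ω : Type*} [TopologicalSpace Ω] [MeasurableSpace Ω] [BorelSpace Ω]
  {𝔓 : Set (ProbabilityMeasure Ω)} {φ : 𝔓 → OrliczFunction}
  {hdom : ∀ x : ℝ≥0, phiMax φ x < ∞}

/-- On bounded continuous functions, every continuous linear functional on the closure is
integration against a signed measure with norm-dominated total variation. -/
theorem exists_normDominated_forall_integral_eq [LindelofSpace Ω] [T35Space Ω]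
    (hcompact : IsCompact 𝔓) (L : StrongDual ℝ (closureCb φ)) :
    ∃ ν : SignedMeasure Ω, NormDominated hdom ν.totalVariation ∧
      ∀ g : Ω →ᵇ ℝ, L (ofBCF φ hdom g) = ∫ᵛ ω, g ω ∂<•ν := by
  obtain ⟨μ₁, μ₂, h₁, h₂, hsub, hle⟩ := exists_measures_integral_sub_eq
    (L.toLinearMap ∘ₗ ofBCF φ hdom) (fun g => ‖L‖ * ‖ofBCF φ hdom g‖)
    (fun f g hg0 hgf => by
      refine (L.le_opNorm _).trans ?_
      gcongr
      exact norm_ofBCF_mono hdom fun ω => abs_le_abs_of_nonneg (hg0 ω) (hgf ω))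
    (fun f hf hf0 => by
      have hnonneg : ∀ n, 0 ≤ f n := fun n ω =>
        le_of_tendsto (hf0 ω) (eventually_ge_atTop n |>.mono fun m hm => hf hm ω)
      have hpos : ∀ n ω, (0 : ℝ) ≤ f n ω := fun n ω => hnonneg n ω
      have h := tendsto_norm_ofBCF_zero hdom hcompact hf hnonneg fun P _ => by
        simpa using tendsto_integral_of_dominated_convergence (F := fun n ω => f n ω)
          (f := fun _ => 0) (μ := (P : Measure Ω)) (fun ω => f 0 ω)
          (fun n => (f n).continuous.aestronglyMeasurable) ((f 0).integrable _)
          (fun n => ae_of_all _ fun ω => by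
            rw [Real.norm_of_nonneg (hpos n ω)]; exact hf (Nat.zero_le n) ω)
          (ae_of_all _ hf0)
      simpa using h.const_mul ‖L‖)
  have hdom' : ∀ (μ : Measure Ω) [IsFiniteMeasure μ],
      (∀ f : Ω →ᵇ ℝ, 0 ≤ f → ∫ ω, f ω ∂μ ≤ ‖L‖ * ‖ofBCF φ hdom f‖) → NormDominated hdom μ := by
    intro μ _ hμ
    refine ⟨‖L‖, fun g => ?_⟩
    have habs : ∀ ω, |g| ω = ‖g ω‖ := fun ω => rfl
    rw [← ofReal_integral_norm_eq_lintegral_enorm (g.integrable _)]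
    refine ENNReal.ofReal_le_ofReal ((hμ |g| (abs_nonneg g)).trans ?_)
    gcongr
    exact norm_ofBCF_mono hdom fun ω => by rw [habs, norm_norm]
  refine ⟨μ₁.toSignedMeasure - μ₂.toSignedMeasure, ?_, fun g => ?_⟩
  · refine ((hdom' μ₁ fun f hf => (hle f hf).1).add (hdom' μ₂ fun f hf => (hle f hf).2)).mono ?_
    rw [SignedMeasure.totalVariation_eq_variation]
    refine VectorMeasure.variation_sub_le.trans ?_
    rw [Measure.variation_toSignedMeasure, Measure.variation_toSignedMeasure]
  · rw [integral_toSignedMeasure_sub (g.integrable _) (g.integrable _)]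
    exact (hsub g).symm

end Surjective

end RobustOrlicz

theorem corollary4p3 {Ω : Type*} [TopologicalSpace Ω] [TopologicalSpace.SeparableSpace Ω]
    [TopologicalSpace.MetrizableSpace Ω] [MeasurableSpace Ω] [BorelSpace Ω]
    (𝔓 : Set (ProbabilityMeasure Ω)) (h𝔓 : 𝔓.Nonempty) (hcompact : IsCompact 𝔓)
    (φ : 𝔓 → OrliczFunction) (hdom : ∀ x : ℝ≥0, RobustOrlicz.phiMax φ x < ∞) :
    ∃ (V : Submodule ℝ (SignedMeasure Ω))
      (T : V ≃ₗ[ℝ] StrongDual ℝ (RobustOrlicz.closureCb φ)),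
      (V : Set (SignedMeasure Ω)) = RobustOrlicz.ca φ (RobustOrlicz.closureCb φ) ∧
      ∀ (μ : V) (X : RobustOrlicz.closureCb φ) (f : Ω → ℝ),
        RobustOrlicz.IsRep f
          ((X : RobustOrlicz.space φ) : (RobustOrlicz.qs 𝔓).Germ ℝ) →
        T μ X = ∫ᵛ ω, f ω ∂<•(μ : SignedMeasure Ω) := by
  let := TopologicalSpace.metrizableSpaceMetric Ω
  have : SecondCountableTopology Ω := UniformSpace.secondCountable_of_separable Ω
  let V : Submodule ℝ (SignedMeasure Ω) :=
    { carrier := {ν | RobustOrlicz.NormDominated hdom ν.totalVariation}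
      zero_mem' := ⟨0, fun g => by simp [SignedMeasure.totalVariation_zero]⟩
      add_mem' := fun {μ ν} hμ hν => by
        refine (RobustOrlicz.NormDominated.add hμ hν).mono ?_
        simp only [SignedMeasure.totalVariation_eq_variation]
        exact VectorMeasure.variation_add_le
      smul_mem' := fun c ν hν => by
        refine (RobustOrlicz.NormDominated.smul hν ‖c‖₊).mono ?_
        simp only [SignedMeasure.totalVariation_eq_variation]
        exact VectorMeasure.variation_smul.le }
  choose D hD using fun ν : V => RobustOrlicz.NormDominated.exists_dual hcompact ν.2
  have hint : ∀ (ν : V) (X : RobustOrlicz.closureCb φ) (f : Ω → ℝ),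
      RobustOrlicz.IsRep f ((X : RobustOrlicz.space φ) : (RobustOrlicz.qs 𝔓).Germ ℝ) →
        (ν : SignedMeasure Ω).Integrable f := by
    intro ν X f hf
    rw [VectorMeasure.Integrable, ← SignedMeasure.totalVariation_eq_variation]
    exact RobustOrlicz.NormDominated.integrable hcompact ν.2 hf
  let T₀ : V →ₗ[ℝ] StrongDual ℝ (RobustOrlicz.closureCb φ) :=
    { toFun := D
      map_add' μ ν := by
        ext X
        obtain ⟨f, hf⟩ := RobustOrlicz.exists_isRep X
        rw [add_apply, hD _ X f hf, hD _ X f hf, hD _ X f hf]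
        exact VectorMeasure.integral_add_vectorMeasure (hint μ X f hf) (hint ν X f hf)
      map_smul' c ν := by
        ext X
        obtain ⟨f, hf⟩ := RobustOrlicz.exists_isRep X
        rw [smul_apply, hD _ X f hf, hD _ X f hf]
        exact VectorMeasure.integral_smul_vectorMeasure f c }
  have hbij : Function.Bijective T₀ := by
    refine ⟨fun μ ν hμν => Subtype.ext ?_, fun L => ?_⟩
    · refine RobustOrlicz.eq_of_forall_integral_boundedContinuousFunction_eq fun g => ?_
      rw [← hD μ _ _ (RobustOrlicz.isRep_ofBCF hdom g),
        ← hD ν _ _ (RobustOrlicz.isRep_ofBCF hdom g)]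
      exact congrArg (fun L : StrongDual ℝ (RobustOrlicz.closureCb φ) =>
        L (RobustOrlicz.ofBCF φ hdom g)) hμν
    · obtain ⟨ν, hν, hL⟩ :=
        RobustOrlicz.exists_normDominated_forall_integral_eq (hdom := hdom) hcompact L
      refine ⟨⟨ν, hν⟩, DFunLike.coe_injective ?_⟩
      refine (RobustOrlicz.denseRange_ofBCF hdom).equalizer (D ⟨ν, hν⟩).continuous L.continuous ?_
      funext g
      exact (hD ⟨ν, hν⟩ _ _ (RobustOrlicz.isRep_ofBCF hdom g)).trans (hL g).symm
  refine ⟨V, LinearEquiv.ofBijective T₀ hbij, ?_, hD⟩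
  ext ν
  exact (RobustOrlicz.mem_ca_closureCb_iff hcompact).symm
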